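/- **Setting.** Let $(\mathcal X,\lambda)$ and $(\mathcal Y,\nu)$ be measurable spaces with $\sigma$-finite reference measures, $p_0(x)$ a probability density on $\mathcal X$, and $\{p_\theta(y|x):\theta\in\mathcal S\}$ a jointly measurable family of conditional probability densities on $\mathcal Y$, indexed by a measurable space $\mathcal S$. Fix a true parameter $\theta_0\in\mathcal S$ and write $p_0(y|x)=p_{\theta_0}(y|x)$. Let $P_\theta$ be the law on $\mathcal X\times\mathcal Y$ with density $p_0(x)p_\theta(y|x)$, $P_0=P_{\theta_0}$, and let $P_0^N$ be the law of $N$ i.i.d. observations $(X,Y)=((X_i,Y_i))_{i\le N}$ from $P_0$. Let $Pr$ be a prior probability measure on $\mathcal S$, with posterior $$Pr(A\mid X,Y)=\frac{\int_A\prod_{i=1}^N p_\theta(Y_i|X_i)\,Pr(d\theta)}{\int_{\mathcal S}\prod_{i=1}^N p_\theta(Y_i|X_i)\,Pr(d\theta)}.$$ Let $d_H(P,Q)=\big(\tfrac12\int(\sqrt{dP}-\sqrt{dQ})^2\big)^{1/2}$ be the Hellinger distance, and let $\mathcal D(\epsilon,\mathcal P,d_H)$ be the $\epsilon$-packing number of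 $\mathcal P$, i.e. the maximal number of points of $\mathcal P$ with pairwise distances at least $\epsilon$. **Theorem.** There is a universal constant $L>0$ with the following property. In any setting as above, let $\varepsilon_N>0$ be a sequence with $\varepsilon_N\to0$ and $N\varepsilon_N^2\to\infty$, let $C>0$ be a constant, and let $\mathcal S_N\subseteq\mathcal S$ be measurable sets such that, for all $N\ge1$, 1. $\log\mathcal D(\varepsilon_N/2,\{P_\theta:\theta\in\mathcal S_N\},d_H)\le N\varepsilon_N^2$; 2. $Pr(\mathcal S\setminus\mathcal S_N)\le e^{-N\varepsilon_N^2(C+4)}$; 3. $Pr\Big(\theta:\ -P_0\log\frac{p_\theta(Y_1|X_1)}{p_0(Y_1|X_1)}\le\varepsilon_N^2,\ \ P_0\Big(\log\frac{p_\theta(Y_1|X_1)}{p_0(Y_1|X_1)}\Big)^2\le\varepsilon_N^2\Big)\ge e^{-N\varepsilon_N^2C}$. Then for every $T>0$ with $LT^2\ge C+4$ and $LT^2-1>L$, every $0<\delta<1$ and every $N\ge1$, $$P_0^N\Big(Pr\big(\theta:d_H(P_\theta,P_0)>T\varepsilon_N\mid X,Y\big)>\delta\Big)\le\frac{1}{N\varepsilon_N^2\delta}+\frac{2e^{-LN\varepsilon_N^2}}{\delta}+\frac{2e^{-2N\varepsilon_N^2}}{\delta}.$$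 -/

import Mathlib

open MeasureTheory Set Filter Topology
open scoped ENNReal NNReal

universe u v w

noncomputable section

/-- The Hellinger distance
`d_H(P, Q) = (1/2 ∫ (√(dP/dρ) - √(dQ/dρ))² dρ)^{1/2}` of two finite measures. Its value does not
depend on the dominating measure; here `ρ = P + Q`. -/
def hellingerDist {Ω : Type*} [MeasurableSpace Ω] (P Q : Measure Ω) : ℝ :=
  √((1 / 2) * ∫ z, (√(P.rnDeriv (P + Q) z).toReal - √(Q.rnDeriv (P + Q) z).toReal) ^ 2 ∂(P + Q))

/-- The `ε`-packing number of a set `A` under a distance function `d`: the maximal number of points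
of `A` such that the distance between any two distinct ones is at least `ε` (`⊤` if there is no
maximum). -/
def packingNum {α : Type*} (ε : ℝ) (A : Set α) (d : α → α → ℝ) : ℕ∞ :=
  ⨆ (F : Set α) (_ : F ⊆ A) (_ : F.Pairwise fun a b => ε ≤ d a b), F.encard

/-- A family of regression models with random covariates, indexed by `θ ∈ Θ`: a density `p₀(x)` of
the covariate, and conditional densities `p(y | x, θ)` of the response, with respect to σ-finite
reference measures on the covariate space `𝒳` and on the response space `𝒴`. -/
structure RegressionModel (Θ 𝒳 𝒴 : Type*) [MeasurableSpace Θ] [MeasurableSpace 𝒳]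
    [MeasurableSpace 𝒴] where
  /-- reference measure for the covariate -/
  covRef : Measure 𝒳
  /-- reference measure for the response -/
  respRef : Measure 𝒴
  sigmaFinite_covRef : SigmaFinite covRef
  sigmaFinite_respRef : SigmaFinite respRef
  /-- the density `p₀(x)` of the covariate -/
  covDensity : 𝒳 → ℝ≥0
  measurable_covDensity : Measurable covDensity
  lintegral_covDensity : ∫⁻ x, (covDensity x : ℝ≥0∞) ∂covRef = 1
  /-- the conditional density `p(y | x, θ)` of the response -/
  condDensity : Θ → 𝒳 → 𝒴 → ℝ≥0
  measurable_condDensity : Measurable fun w : Θ × 𝒳 × 𝒴 => condDensity w.1 w.2.1 w.2.2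
  lintegral_condDensity : ∀ θ x, ∫⁻ y, (condDensity θ x y : ℝ≥0∞) ∂respRef = 1

attribute [instance] RegressionModel.sigmaFinite_covRef RegressionModel.sigmaFinite_respRef

namespace RegressionModel

variable {Θ 𝒳 𝒴 : Type*} [MeasurableSpace Θ] [MeasurableSpace 𝒳] [MeasurableSpace 𝒴]

/-- `P_θ`: the law of one data point `(X₁, Y₁)` under `θ`, with density `p₀(x) p(y | x, θ)`. -/
def law (M : RegressionModel Θ 𝒳 𝒴) (θ : Θ) : Measure (𝒳 × 𝒴) :=
  (M.covRef.prod M.respRef).withDensity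
    fun z => (M.covDensity z.1 : ℝ≥0∞) * (M.condDensity θ z.1 z.2 : ℝ≥0∞)

/-- `P_θ^N`: the law of `N` independent data points under `θ`. -/
def dataLaw (M : RegressionModel Θ 𝒳 𝒴) (θ : Θ) (N : ℕ) : Measure (Fin N → 𝒳 × 𝒴) :=
  Measure.pi fun _ => M.law θ

/-- The likelihood `∏ᵢ p(yᵢ | xᵢ, θ)` of the data. -/
def likelihood (M : RegressionModel Θ 𝒳 𝒴) {N : ℕ} (D : Fin N → 𝒳 × 𝒴) (θ : Θ) : ℝ≥0∞ :=
  ∏ i, (M.condDensity θ (D i).1 (D i).2 : ℝ≥0∞)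

/-- The posterior probability of `A` given the data, for the prior `Pr`. -/
def posterior (M : RegressionModel Θ 𝒳 𝒴) (Pr : Measure Θ) {N : ℕ} (D : Fin N → 𝒳 × 𝒴)
    (A : Set Θ) : ℝ≥0∞ :=
  (∫⁻ θ in A, M.likelihood D θ ∂Pr) / ∫⁻ θ, M.likelihood D θ ∂Pr

/-- The log-likelihood ratio `log (p(y | x, θ) / p(y | x, θ₀))` at the data point `z = (x, y)`. -/
def logRatio (M : RegressionModel Θ 𝒳 𝒴) (θ₀ θ : Θ) (z : 𝒳 × 𝒴) : ℝ :=
  Real.log ((M.condDensity θ z.1 z.2 : ℝ) / (M.condDensity θ₀ z.1 z.2 : ℝ))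

/-- The Kullback–Leibler type neighbourhood of the truth: the `θ` with
`-P₀ log (p_θ / p₀) ≤ ε²` and `P₀ (log (p_θ / p₀))² ≤ ε²`. Both moments are infinite when `p_θ`
vanishes with positive `P₀`-probability, so the first clause excludes such `θ` (for which
`Real.log 0 = 0` would give a wrong value). The bound on the second moment, an integral with
values in `[0, ∞]`, makes the first moment an honest integral. -/
def klNhd (M : RegressionModel Θ 𝒳 𝒴) (θ₀ : Θ) (ε : ℝ) : Set Θ :=
  {θ | (∀ᵐ z ∂M.law θ₀, 0 < M.condDensity θ z.1 z.2) ∧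
    -(∫ z, M.logRatio θ₀ θ z ∂M.law θ₀) ≤ ε ^ 2 ∧
    ∫⁻ z, ENNReal.ofReal (M.logRatio θ₀ θ z ^ 2) ∂M.law θ₀ ≤ ENNReal.ofReal (ε ^ 2)}

end RegressionModel

end

/-!
The posterior mass of `A = {θ | d_H(P_θ, P_{θ₀}) > T ε_N}` is a ratio of integrals of likelihoods,
and it is bounded by testing, following Ghosal, Ghosh and van der Vaart. Write `t = N ε_N²`.

*Tests* (`exists_hellinger_test`, `exists_test_of_packingNum_le`). For two densities with roots
`u = √p₀` and `v = √p₁`, put `R = (u + v / 2) / (v + u / 2)`, a version of `√(p₀ / p₁)` with values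
in `[1/2, 2]`. If the data have a density with root `s`, the pointwise inequality
`sq_mul_temperedRatio_le` shows that `R` has expectation at most `1 - ‖u - v‖² / 8 + 7 ‖s - v‖²`.
Hence the test which rejects `p₀` when the product of the `1 / R` over the observations is at least
one has errors at most `exp (-N d² / 8)`, `d = d_H(p₀, p₁)`, uniformly over a Hellinger ball around
`p₁` with radius a small multiple of `d`; no minimax theorem is needed. The constant `L = 1 / 27`
forces `T² > 28`, so balls of radius `ε_N / 2` around points of `A` are small in this sense. A
maximal `ε_N / 2`-packing of the part of `A` in the sieve has at most `exp t` points, so the union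
of their tests has error of the first kind at most `exp (t - t T² / 8)`, and error of the second
kind at most `exp (-t T² / 8) ≤ exp (-t (C + 4))`.

*Evidence* (`dataLaw_evidence_lt_le`). Restrict the denominator to the Kullback–Leibler
neighbourhood. Jensen's inequality bounds the logarithm of the averaged likelihood ratio below by a
sum of independent variables with mean at least `-ε_N²` and second moment at most `ε_N²`, and
Chebyshev's inequality shows that, except with probability `1 / t`, the denominator is at least
`exp (-t (C + 2))` times the true likelihood.

*Conclusion* (`dataLaw_lt_posterior_le`). Where the test accepts, the numerator divided by the true
likelihood has expectation at most the integral over `A` of the errors of the second kind, by a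
change of measure. Splitting `A` along the sieve bounds this by `2 exp (-t (C + 4))`, and Markov's
inequality gives `2 exp (-2 t) / δ` for the probability that it exceeds `δ exp (-t (C + 2))`.
-/

open ProbabilityTheory

/-! ### A bounded approximation of the likelihood ratio -/

/-- The ratio `(u + v / 2) / (v + u / 2)` of two points on the segment between `u` and `v`, used
with `u = √p₀` and `v = √p₁` as a version of `√(p₀ / p₁)` with values in `[1/2, 2]`. Where both
roots vanish it is set to `1`, so that it is positive everywhere and swapping the arguments inverts
it. -/
noncomputable def temperedRatio (u v : ℝ) : ℝ :=
  if u = 0 ∧ v = 0 then 1 else (u + v / 2) / (v + u / 2)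

lemma temperedRatio_pos {u v : ℝ} (hu : 0 ≤ u) (hv : 0 ≤ v) : 0 < temperedRatio u v := by
  unfold temperedRatio
  split_ifs with h
  · exact one_pos
  · have : 0 < u ∨ 0 < v := by
      by_contra! hc
      exact h ⟨le_antisymm hc.1 hu, le_antisymm hc.2 hv⟩
    rcases this with h | h <;> positivity

lemma temperedRatio_mul_swap {u v : ℝ} (hu : 0 ≤ u) (hv : 0 ≤ v) :
    temperedRatio u v * temperedRatio v u = 1 := by
  unfold temperedRatio
  by_cases h : u = 0 ∧ v = 0
  · simp [h]
  · have : 0 < u ∨ 0 < v := by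
      by_contra! hc
      exact h ⟨le_antisymm hc.1 hu, le_antisymm hc.2 hv⟩
    have h1 : 0 < u + v / 2 := by rcases this with h | h <;> positivity
    have h2 : 0 < v + u / 2 := by rcases this with h | h <;> positivity
    rw [if_neg h, if_neg (fun h' => h h'.symm), div_mul_div_comm, mul_comm,
      div_self (mul_pos h2 h1).ne']

lemma temperedRatio_le_two {u v : ℝ} (hu : 0 ≤ u) (hv : 0 ≤ v) : temperedRatio u v ≤ 2 := by
  unfold temperedRatio
  split_ifs with h
  · norm_num
  · apply div_le_of_le_mul₀ <;> linarith

lemma measurable_temperedRatio : Measurable fun w : ℝ × ℝ => temperedRatio w.1 w.2 := by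
  unfold temperedRatio
  refine Measurable.ite ?_ measurable_const (by fun_prop)
  exact ((measurableSet_singleton (0 : ℝ)).preimage measurable_fst).inter
    ((measurableSet_singleton (0 : ℝ)).preimage measurable_snd)

/-- The pointwise inequality behind the robustness of the test: here `s` is the root of the density
of the data, `v` that of a nearby alternative, and `u` that of the null hypothesis. After
integration `s² + (u² - v²) / 6` contributes `1`, the squared distance of `u` and `v` is gained, and
only the squared distance of `s` and `v` is lost. -/
lemma sq_mul_temperedRatio_le {s u v : ℝ} (hu : 0 ≤ u) (hv : 0 ≤ v) :
    s ^ 2 * temperedRatio u v ≤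
      s ^ 2 + (1 / 6) * (u ^ 2 - v ^ 2) - (1 / 8) * (u - v) ^ 2 + 7 * (s - v) ^ 2 := by
  unfold temperedRatio
  split_ifs with h
  · rw [h.1, h.2]; nlinarith [sq_nonneg s]
  have hw : 0 < 2 * v + u := by
    have : 0 < u ∨ 0 < v := by
      by_contra! hc
      exact h ⟨le_antisymm hc.1 hu, le_antisymm hc.2 hv⟩
    rcases this with h | h <;> linarith
  -- `k` is the ratio minus one; it lies in `[-1/2, 1]`.
  set k := (u - v) / (2 * v + u) with hk
  have hkw : k * (2 * v + u) = u - v := by rw [hk, div_mul_cancel₀ _ hw.ne']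
  have hR : (u + v / 2) / (v + u / 2) = 1 + k := by
    rw [div_eq_iff (by linarith)]
    linear_combination (-1 / 2) * hkw
  have hk1 : k ≤ 1 := by rw [hk, div_le_one hw]; linarith
  have hk2 : -1 ≤ k := by rw [hk, le_div_iff₀ hw]; linarith
  rw [hR]
  have h1 : v ^ 2 * k ≤ (1 / 3) * (v * (u - v)) := by
    have : v ^ 2 * k - (1 / 3) * (v * (u - v)) = -(1 / 3) * (v * (k ^ 2 * (2 * v + u))) := by
      rw [← hkw]
      linear_combination (1 / 3 * v * k) * hkw
    have : 0 ≤ v * (k ^ 2 * (2 * v + u)) := by positivity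
    linarith
  have h2 : (2 * (v * k)) ^ 2 ≤ (u - v) ^ 2 := by
    rw [← hkw, mul_pow, mul_pow, mul_pow]
    nlinarith [mul_nonneg (sq_nonneg k) (mul_nonneg hu hv), mul_nonneg (sq_nonneg k) (sq_nonneg u)]
  have h3 : (s - v) ^ 2 * k ≤ (s - v) ^ 2 := by nlinarith [sq_nonneg (s - v)]
  have h4 : 2 * (v * k) * (s - v) ≤ (1 / 24) * (u - v) ^ 2 + 6 * (s - v) ^ 2 := by
    nlinarith [sq_nonneg (2 * (v * k) - 12 * (s - v))]
  nlinarith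

/-! ### Laws given by densities -/

section Density

variable {Z : Type*} [MeasurableSpace Z] {κ : Measure Z}

lemma integrable_coe_of_lintegral_eq_one {p : Z → ℝ≥0} (hp : Measurable p)
    (hp1 : ∫⁻ z, (p z : ℝ≥0∞) ∂κ = 1) : Integrable (fun z => (p z : ℝ)) κ := by
  refine ⟨by fun_prop, ?_⟩
  simp [HasFiniteIntegral, enorm_eq_nnnorm, hp1]

lemma integral_coe_of_lintegral_eq_one {p : Z → ℝ≥0} (hp : Measurable p)
    (hp1 : ∫⁻ z, (p z : ℝ≥0∞) ∂κ = 1) : ∫ z, (p z : ℝ) ∂κ = 1 := by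
  rw [integral_eq_lintegral_of_nonneg_ae (ae_of_all _ fun z => (p z).coe_nonneg)
    (by fun_prop)]
  simp [hp1]

lemma isProbabilityMeasure_withDensity_of_lintegral_eq_one {p : Z → ℝ≥0}
    (hp1 : ∫⁻ z, (p z : ℝ≥0∞) ∂κ = 1) :
    IsProbabilityMeasure (κ.withDensity fun z => (p z : ℝ≥0∞)) :=
  ⟨by simp [hp1]⟩

lemma integrable_sq_sqrt_sub_sqrt {p q : Z → ℝ≥0} (hp : Measurable p) (hq : Measurable q)
    (hp1 : ∫⁻ z, (p z : ℝ≥0∞) ∂κ = 1) (hq1 : ∫⁻ z, (q z : ℝ≥0∞) ∂κ = 1) :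
    Integrable (fun z => (√(p z : ℝ) - √(q z : ℝ)) ^ 2) κ := by
  refine ((integrable_coe_of_lintegral_eq_one hp hp1).add
    (integrable_coe_of_lintegral_eq_one hq hq1)).mono (by fun_prop) (ae_of_all _ fun z => ?_)
  have h1 := Real.sq_sqrt (p z).coe_nonneg
  have h2 := Real.sq_sqrt (q z).coe_nonneg
  have : 0 ≤ √(p z : ℝ) * √(q z : ℝ) := by positivity
  rw [Real.norm_of_nonneg (by positivity), Pi.add_apply,
    Real.norm_of_nonneg (add_nonneg (p z).coe_nonneg (q z).coe_nonneg)]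
  nlinarith

/-- The Hellinger distance may be computed with any dominating measure. -/
lemma hellingerDist_withDensity [SigmaFinite κ] {p q : Z → ℝ≥0} (hp : Measurable p)
    (hq : Measurable q) :
    hellingerDist (κ.withDensity fun z => (p z : ℝ≥0∞)) (κ.withDensity fun z => (q z : ℝ≥0∞)) =
      √((1 / 2) * ∫ z, (√(p z : ℝ) - √(q z : ℝ)) ^ 2 ∂κ) := by
  have hadd : (κ.withDensity fun z => (p z : ℝ≥0∞)) + (κ.withDensity fun z => (q z : ℝ≥0∞)) =
      κ.withDensity fun z => ((p z + q z : ℝ≥0) : ℝ≥0∞) := by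
    rw [← withDensity_add_left (by fun_prop)]
    rfl
  have hsf : SigmaFinite (κ.withDensity fun z => ((p z + q z : ℝ≥0) : ℝ≥0∞)) :=
    SigmaFinite.withDensity _
  have key : ∀ r : Z → ℝ≥0, Measurable r → (∀ z, r z ≤ p z + q z) →
      (κ.withDensity fun z => (r z : ℝ≥0∞)).rnDeriv
        (κ.withDensity fun z => ((p z + q z : ℝ≥0) : ℝ≥0∞))
        =ᵐ[κ.withDensity fun z => ((p z + q z : ℝ≥0) : ℝ≥0∞)]
        fun z => ((r z / (p z + q z) : ℝ≥0) : ℝ≥0∞) := by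
    intro r hr hle
    have : (κ.withDensity fun z => (r z : ℝ≥0∞)) =
        (κ.withDensity fun z => ((p z + q z : ℝ≥0) : ℝ≥0∞)).withDensity
          fun z => ((r z / (p z + q z) : ℝ≥0) : ℝ≥0∞) := by
      rw [← withDensity_mul _ (by fun_prop) (by fun_prop)]
      congr 1
      ext z
      rw [Pi.mul_apply, ← ENNReal.coe_mul]
      congr 1
      by_cases h0 : p z + q z = 0
      · rw [h0, zero_mul]; exact le_antisymm (h0 ▸ hle z) zero_le
      · field_simp
    rw [this]
    exact Measure.rnDeriv_withDensity _ (by fun_prop)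
  unfold hellingerDist
  rw [hadd]
  congr 2
  have hcongr : ∫ z, (√((κ.withDensity fun z => (p z : ℝ≥0∞)).rnDeriv
        (κ.withDensity fun z => ((p z + q z : ℝ≥0) : ℝ≥0∞)) z).toReal -
      √((κ.withDensity fun z => (q z : ℝ≥0∞)).rnDeriv
        (κ.withDensity fun z => ((p z + q z : ℝ≥0) : ℝ≥0∞)) z).toReal) ^ 2
        ∂(κ.withDensity fun z => ((p z + q z : ℝ≥0) : ℝ≥0∞)) =
      ∫ z, (√((p z / (p z + q z) : ℝ≥0) : ℝ) - √((q z / (p z + q z) : ℝ≥0) : ℝ)) ^ 2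
        ∂(κ.withDensity fun z => ((p z + q z : ℝ≥0) : ℝ≥0∞)) := by
    refine integral_congr_ae ?_
    filter_upwards [key p hp fun z => le_self_add, key q hq fun z => le_add_self] with z h1 h2
    rw [h1, h2]; rfl
  rw [hcongr, integral_withDensity_eq_integral_smul (by fun_prop)]
  refine integral_congr_ae (ae_of_all _ fun z => ?_)
  simp only [NNReal.smul_def, smul_eq_mul, NNReal.coe_div]
  rw [Real.sqrt_div (p z).coe_nonneg, Real.sqrt_div (q z).coe_nonneg, ← sub_div, div_pow,
    Real.sq_sqrt (p z + q z).coe_nonneg]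
  by_cases h0 : ((p z + q z : ℝ≥0) : ℝ) = 0
  · have hp0 : (p z : ℝ) = 0 := by
      have := (p z).coe_nonneg
      have := (q z).coe_nonneg
      push_cast at h0
      linarith
    have hq0 : (q z : ℝ) = 0 := by
      have := (p z).coe_nonneg
      have := (q z).coe_nonneg
      push_cast at h0
      linarith
    simp [hp0, hq0]
  · field_simp

lemma hellingerDist_sq_withDensity [SigmaFinite κ] {p q : Z → ℝ≥0} (hp : Measurable p)
    (hq : Measurable q) :
    hellingerDist (κ.withDensity fun z => (p z : ℝ≥0∞))
      (κ.withDensity fun z => (q z : ℝ≥0∞)) ^ 2 =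
      (1 / 2) * ∫ z, (√(p z : ℝ) - √(q z : ℝ)) ^ 2 ∂κ := by
  rw [hellingerDist_withDensity hp hq, Real.sq_sqrt]
  exact mul_nonneg (by norm_num) (integral_nonneg fun z => sq_nonneg _)

lemma hellingerDist_nonneg (P Q : Measure Z) : 0 ≤ hellingerDist P Q := Real.sqrt_nonneg _

lemma hellingerDist_comm (P Q : Measure Z) : hellingerDist P Q = hellingerDist Q P := by
  unfold hellingerDist
  rw [add_comm P Q]
  congr 2
  exact integral_congr_ae (ae_of_all _ fun z => by ring)

lemma hellingerDist_self (P : Measure Z) : hellingerDist P P = 0 := by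
  simp [hellingerDist]

/-- If the data have density `p` close to `p₁` in Hellinger distance, then the tempered version of
`√(p₀ / p₁)` has expectation well below one. -/
lemma lintegral_temperedRatio_le [SigmaFinite κ] {p p₀ p₁ : Z → ℝ≥0} (hp : Measurable p)
    (hp₀ : Measurable p₀) (hp₁ : Measurable p₁) (h1 : ∫⁻ z, (p z : ℝ≥0∞) ∂κ = 1)
    (h1₀ : ∫⁻ z, (p₀ z : ℝ≥0∞) ∂κ = 1) (h1₁ : ∫⁻ z, (p₁ z : ℝ≥0∞) ∂κ = 1) {d r : ℝ}
    (hd : hellingerDist (κ.withDensity fun z => (p₀ z : ℝ≥0∞))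
      (κ.withDensity fun z => (p₁ z : ℝ≥0∞)) = d)
    (hr : hellingerDist (κ.withDensity fun z => (p z : ℝ≥0∞))
      (κ.withDensity fun z => (p₁ z : ℝ≥0∞)) = r)
    (hrd : 112 * r ^ 2 ≤ d ^ 2) :
    ∫⁻ z, ENNReal.ofReal (temperedRatio √(p₀ z : ℝ) √(p₁ z : ℝ))
      ∂(κ.withDensity fun z => (p z : ℝ≥0∞)) ≤ ENNReal.ofReal (Real.exp (-(d ^ 2 / 8))) := by
  set R : Z → ℝ := fun z => temperedRatio √(p₀ z : ℝ) √(p₁ z : ℝ) with hR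
  have hRm : Measurable R :=
    measurable_temperedRatio.comp (f := fun z => (√(p₀ z : ℝ), √(p₁ z : ℝ))) (by fun_prop)
  have hRpos : ∀ z, 0 < R z := fun z => temperedRatio_pos (Real.sqrt_nonneg _) (Real.sqrt_nonneg _)
  have hR2 : ∀ z, R z ≤ 2 := fun z =>
    temperedRatio_le_two (Real.sqrt_nonneg _) (Real.sqrt_nonneg _)
  have hip := integrable_coe_of_lintegral_eq_one hp h1
  have hip₀ := integrable_coe_of_lintegral_eq_one hp₀ h1₀
  have hip₁ := integrable_coe_of_lintegral_eq_one hp₁ h1₁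
  have hd2 := hellingerDist_sq_withDensity (κ := κ) hp₀ hp₁
  have hr2 := hellingerDist_sq_withDensity (κ := κ) hp hp₁
  rw [hd] at hd2
  rw [hr] at hr2
  have hi1 := integrable_sq_sqrt_sub_sqrt hp₀ hp₁ h1₀ h1₁
  have hi2 := integrable_sq_sqrt_sub_sqrt hp hp₁ h1 h1₁
  have hint : Integrable (fun z => (p z : ℝ) * R z) κ := by
    refine (hip.const_mul 2).mono (by fun_prop) (ae_of_all _ fun z => ?_)
    rw [Real.norm_of_nonneg (mul_nonneg (p z).coe_nonneg (hRpos z).le),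
      Real.norm_of_nonneg (mul_nonneg zero_le_two (p z).coe_nonneg)]
    have := mul_le_mul_of_nonneg_left (hR2 z) (p z).coe_nonneg
    linarith
  rw [lintegral_withDensity_eq_lintegral_mul _ (by fun_prop) hRm.ennreal_ofReal]
  have hpt : ∀ z, ((fun z => (p z : ℝ≥0∞)) * fun z => ENNReal.ofReal (R z)) z =
      ENNReal.ofReal ((p z : ℝ) * R z) := fun z => by
    rw [Pi.mul_apply, ENNReal.ofReal_mul (p z).coe_nonneg, ENNReal.ofReal_coe_nnreal]
  simp_rw [hpt]
  rw [← ofReal_integral_eq_lintegral_ofReal hint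
    (ae_of_all _ fun z => mul_nonneg (p z).coe_nonneg (hRpos z).le)]
  apply ENNReal.ofReal_le_ofReal
  have hip₀₁ : Integrable (fun z => (p₀ z : ℝ) - (p₁ z : ℝ)) κ := hip₀.sub hip₁
  have hi3 : Integrable (fun z => (p z : ℝ) + (1 / 6) * ((p₀ z : ℝ) - (p₁ z : ℝ))) κ :=
    hip.add (hip₀₁.const_mul _)
  have hi4 : Integrable (fun z => (p z : ℝ) + (1 / 6) * ((p₀ z : ℝ) - (p₁ z : ℝ))
      - (1 / 8) * (√(p₀ z : ℝ) - √(p₁ z : ℝ)) ^ 2) κ := hi3.sub (hi1.const_mul _)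
  have hle : ∫ z, (p z : ℝ) * R z ∂κ ≤
      ∫ z, ((p z : ℝ) + (1 / 6) * ((p₀ z : ℝ) - (p₁ z : ℝ))
        - (1 / 8) * (√(p₀ z : ℝ) - √(p₁ z : ℝ)) ^ 2 + 7 * (√(p z : ℝ) - √(p₁ z : ℝ)) ^ 2) ∂κ := by
    refine integral_mono hint (hi4.add (hi2.const_mul 7)) fun z => ?_
    have := sq_mul_temperedRatio_le (s := √(p z : ℝ)) (Real.sqrt_nonneg (p₀ z : ℝ))
      (Real.sqrt_nonneg (p₁ z : ℝ))
    rwa [Real.sq_sqrt (p z).coe_nonneg, Real.sq_sqrt (p₀ z).coe_nonneg,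
      Real.sq_sqrt (p₁ z).coe_nonneg] at this
  rw [integral_add hi4 (hi2.const_mul 7), integral_sub hi3 (hi1.const_mul _),
    integral_add hip (hip₀₁.const_mul _), integral_const_mul, integral_const_mul,
    integral_const_mul, integral_sub hip₀ hip₁, integral_coe_of_lintegral_eq_one hp h1,
    integral_coe_of_lintegral_eq_one hp₀ h1₀, integral_coe_of_lintegral_eq_one hp₁ h1₁] at hle
  have := Real.add_one_le_exp (-(d ^ 2 / 8))
  linarith

end Density

/-! ### Product measures -/

section Pi

variable {Z : Type*} [MeasurableSpace Z]

/-- **Tonelli's theorem** for a product of functions of separate coordinates. -/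
lemma lintegral_pi_fin_prod {n : ℕ} {μ : Measure Z} [SigmaFinite μ] {f : Fin n → Z → ℝ≥0∞}
    (hf : ∀ i, Measurable (f i)) :
    ∫⁻ x, ∏ i, f i (x i) ∂(Measure.pi fun _ : Fin n => μ) = ∏ i, ∫⁻ z, f i z ∂μ := by
  induction n with
  | zero => simp
  | succ n ih =>
    have hm : Measurable fun x : Fin (n + 1) → Z => ∏ i, f i (x i) :=
      Finset.measurable_prod _ fun i _ => (hf i).comp (measurable_pi_apply i)
    rw [← ((measurePreserving_piFinSuccAbove (fun _ : Fin (n + 1) => μ) 0).symm).lintegral_comp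
      hm]
    simp_rw [MeasurableEquiv.piFinSuccAbove_symm_apply, Fin.insertNthEquiv,
      Fin.prod_univ_succ, Fin.insertNth_zero]
    simp only [Equiv.coe_fn_mk, Fin.cons_succ, Fin.cons_zero, cast_eq]
    have hm' : Measurable fun x : Fin n → Z => ∏ i, f i.succ (x i) :=
      Finset.measurable_prod _ fun i _ => (hf i.succ).comp (measurable_pi_apply i)
    exact (lintegral_prod_mul (hf 0).aemeasurable hm'.aemeasurable).trans
      (congrArg _ (ih fun i => hf i.succ))

/-- The law of independent observations with density `p` has the product density. -/
lemma pi_withDensity_eq {n : ℕ} {κ : Measure Z} [SigmaFinite κ] {p : Z → ℝ≥0}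
    (hp : Measurable p) :
    (Measure.pi fun _ : Fin n => κ.withDensity fun z => (p z : ℝ≥0∞)) =
      (Measure.pi fun _ : Fin n => κ).withDensity fun x => ∏ i, (p (x i) : ℝ≥0∞) := by
  have : SigmaFinite (κ.withDensity fun z => (p z : ℝ≥0∞)) := SigmaFinite.withDensity _
  refine Measure.pi_eq fun s hs => ?_
  rw [withDensity_apply _ (MeasurableSet.univ_pi hs),
    ← lintegral_indicator (MeasurableSet.univ_pi hs)]
  have : ∀ x : Fin n → Z, (univ.pi s).indicator (fun x => ∏ i, (p (x i) : ℝ≥0∞)) x =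
      ∏ i, (s i).indicator (fun z => (p z : ℝ≥0∞)) (x i) := by
    intro x
    by_cases hx : x ∈ univ.pi s
    · rw [indicator_of_mem hx]
      exact Finset.prod_congr rfl fun i _ =>
        (indicator_of_mem (hx i (mem_univ i)) fun z => (p z : ℝ≥0∞)).symm
    · rw [indicator_of_notMem hx]
      simp only [Set.mem_pi, mem_univ, true_implies, not_forall] at hx
      obtain ⟨i, hi⟩ := hx
      exact (Finset.prod_eq_zero (Finset.mem_univ i) (indicator_of_notMem hi _)).symm
  simp_rw [this]
  rw [lintegral_pi_fin_prod fun i => Measurable.indicator (by fun_prop) (hs i)]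
  refine Finset.prod_congr rfl fun i _ => ?_
  rw [lintegral_indicator (hs i), withDensity_apply _ (hs i)]

/-- Chernoff's bound: the probability that a product of independent factors reaches one. -/
lemma pi_one_le_prod_le {n : ℕ} {μ : Measure Z} [SigmaFinite μ] {g : Z → ℝ≥0∞}
    (hg : Measurable g) {b : ℝ≥0∞} (hb : ∫⁻ z, g z ∂μ ≤ b) :
    (Measure.pi fun _ : Fin n => μ) {x | 1 ≤ ∏ i, g (x i)} ≤ b ^ n := by
  calc (Measure.pi fun _ : Fin n => μ) {x | 1 ≤ ∏ i, g (x i)}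
      = 1 * (Measure.pi fun _ : Fin n => μ) {x | 1 ≤ ∏ i, g (x i)} := (one_mul _).symm
    _ ≤ ∫⁻ x, ∏ i, g (x i) ∂(Measure.pi fun _ : Fin n => μ) :=
        mul_meas_ge_le_lintegral (Finset.measurable_prod _ fun i _ =>
          hg.comp (measurable_pi_apply i)) 1
    _ = ∏ _i : Fin n, ∫⁻ z, g z ∂μ := lintegral_pi_fin_prod fun _ => hg
    _ ≤ b ^ n := by
        rw [Finset.prod_const, Finset.card_univ, Fintype.card_fin]
        gcongr

end Pi

/-! ### Robust tests between a point and a Hellinger ball -/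

section Test

variable {Z : Type*} [MeasurableSpace Z] {κ : Measure Z} [SigmaFinite κ]

/-- There is a test of `p₀` against the Hellinger ball around `p₁` of radius a small multiple of
`d = d_H(p₀, p₁)`, whose errors of both kinds are at most `exp(-n d² / 8)`. -/
lemma exists_hellinger_test (n : ℕ) {p₀ p₁ : Z → ℝ≥0}
    (hp₀ : Measurable p₀) (hp₁ : Measurable p₁)
    (h1₀ : ∫⁻ z, (p₀ z : ℝ≥0∞) ∂κ = 1) (h1₁ : ∫⁻ z, (p₁ z : ℝ≥0∞) ∂κ = 1) {d : ℝ}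
    (hd : hellingerDist (κ.withDensity fun z => (p₀ z : ℝ≥0∞))
      (κ.withDensity fun z => (p₁ z : ℝ≥0∞)) = d) :
    ∃ E : Set (Fin n → Z), MeasurableSet E ∧
      (Measure.pi fun _ : Fin n => κ.withDensity fun z => (p₀ z : ℝ≥0∞)) E ≤
        ENNReal.ofReal (Real.exp (-(n * (d ^ 2 / 8)))) ∧
      ∀ p : Z → ℝ≥0, Measurable p → ∫⁻ z, (p z : ℝ≥0∞) ∂κ = 1 →
        112 * hellingerDist (κ.withDensity fun z => (p z : ℝ≥0∞))
          (κ.withDensity fun z => (p₁ z : ℝ≥0∞)) ^ 2 ≤ d ^ 2 →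
        (Measure.pi fun _ : Fin n => κ.withDensity fun z => (p z : ℝ≥0∞)) Eᶜ ≤
          ENNReal.ofReal (Real.exp (-(n * (d ^ 2 / 8)))) := by
  have hpow : ENNReal.ofReal (Real.exp (-(n * (d ^ 2 / 8)))) =
      ENNReal.ofReal (Real.exp (-(d ^ 2 / 8))) ^ n := by
    rw [← ENNReal.ofReal_pow (Real.exp_pos _).le, ← Real.exp_nat_mul]
    congr 2; ring
  have hm : ∀ q r : Z → ℝ≥0, Measurable q → Measurable r →
      Measurable fun z => ENNReal.ofReal (temperedRatio √(q z : ℝ) √(r z : ℝ)) := fun q r hq hr =>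
    (measurable_temperedRatio.comp
      (f := fun z => (√(q z : ℝ), √(r z : ℝ))) (by fun_prop)).ennreal_ofReal
  have hsf : ∀ q : Z → ℝ≥0, SigmaFinite (κ.withDensity fun z => (q z : ℝ≥0∞)) :=
    fun q => SigmaFinite.withDensity _
  refine ⟨{x | 1 ≤ ∏ i, ENNReal.ofReal (temperedRatio √(p₁ (x i) : ℝ) √(p₀ (x i) : ℝ))},
    measurableSet_le measurable_const (Finset.measurable_prod _ fun i _ =>
      (hm p₁ p₀ hp₁ hp₀).comp (measurable_pi_apply i)), ?_, fun p hp h1 hpd => ?_⟩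
  · rw [hpow]
    refine pi_one_le_prod_le (hm p₁ p₀ hp₁ hp₀)
      (lintegral_temperedRatio_le hp₀ hp₁ hp₀ h1₀ h1₁ h1₀
        (hellingerDist_comm _ _ |>.trans hd) (hellingerDist_self _) ?_)
    nlinarith [sq_nonneg d]
  · rw [hpow]
    refine (measure_mono ?_).trans (pi_one_le_prod_le (hm p₀ p₁ hp₀ hp₁)
      (lintegral_temperedRatio_le hp hp₀ hp₁ h1 h1₀ h1₁ hd rfl hpd))
    intro x hx
    simp only [mem_compl_iff, mem_ofPred_eq, not_le] at hx ⊢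
    have hprod : (∏ i, ENNReal.ofReal (temperedRatio √(p₁ (x i) : ℝ) √(p₀ (x i) : ℝ))) *
        ∏ i, ENNReal.ofReal (temperedRatio √(p₀ (x i) : ℝ) √(p₁ (x i) : ℝ)) = 1 := by
      rw [← Finset.prod_mul_distrib]
      refine Finset.prod_eq_one fun i _ => ?_
      rw [← ENNReal.ofReal_mul (temperedRatio_pos (Real.sqrt_nonneg _) (Real.sqrt_nonneg _)).le,
        temperedRatio_mul_swap (Real.sqrt_nonneg _) (Real.sqrt_nonneg _), ENNReal.ofReal_one]
    rw [← hprod]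
    exact mul_le_of_le_one_left zero_le hx.le

end Test

/-! ### Maximal packings -/

/-- A maximal packing is a net. -/
lemma exists_packing_forall_exists_lt {α : Type*} {d : α → α → ℝ} (hsymm : ∀ a b, d a b = d b a)
    (hself : ∀ a, d a a = 0) {r : ℝ} (hr : 0 < r) (A : Set α) :
    ∃ F ⊆ A, (F.Pairwise fun a b => r ≤ d a b) ∧ ∀ a ∈ A, ∃ b ∈ F, d a b < r := by
  obtain ⟨F, hF⟩ := zorn_subset {F : Set α | F ⊆ A ∧ F.Pairwise fun a b => r ≤ d a b} (by
    intro c hc hchain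
    refine ⟨⋃₀ c, ⟨sUnion_subset fun s hs => (hc hs).1, ?_⟩, fun s hs => subset_sUnion_of_mem hs⟩
    exact (pairwise_sUnion hchain.directedOn).2 fun s hs => (hc hs).2)
  refine ⟨F, hF.prop.1, hF.prop.2, fun a ha => ?_⟩
  by_contra! hfar
  have hins : insert a F ∈ {F : Set α | F ⊆ A ∧ F.Pairwise fun a b => r ≤ d a b} := by
    refine ⟨insert_subset ha hF.prop.1, hF.prop.2.insert fun b hb _ => ⟨hfar b hb, ?_⟩⟩
    rw [hsymm]; exact hfar b hb
  have haF : a ∈ F := hF.le_of_ge hins (subset_insert a F) (mem_insert a F)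
  have := hfar a haF
  rw [hself] at this
  linarith

lemma encard_le_packingNum {α : Type*} {d : α → α → ℝ} {r : ℝ} {A F : Set α} (hFA : F ⊆ A)
    (hF : F.Pairwise fun a b => r ≤ d a b) : F.encard ≤ packingNum r A d :=
  le_iSup₂_of_le F hFA (le_iSup_of_le hF le_rfl)

namespace RegressionModel

variable {Θ 𝒳 𝒴 : Type*} [MeasurableSpace Θ] [MeasurableSpace 𝒳] [MeasurableSpace 𝒴]

/-! ### The laws and the likelihood of a regression model -/

/-- The dominating measure of the laws `P_θ` in which the known density of the covariate is
absorbed, so that `P_θ` has density `p(y | x, θ)`. -/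
noncomputable def baseRef (M : RegressionModel Θ 𝒳 𝒴) : Measure (𝒳 × 𝒴) :=
  (M.covRef.withDensity fun x => (M.covDensity x : ℝ≥0∞)).prod M.respRef

instance (M : RegressionModel Θ 𝒳 𝒴) : SigmaFinite M.baseRef := by
  have : SigmaFinite (M.covRef.withDensity fun x => (M.covDensity x : ℝ≥0∞)) :=
    SigmaFinite.withDensity _
  unfold baseRef; infer_instance

/-- The density of `P_θ` with respect to `M.baseRef`. -/
def dens (M : RegressionModel Θ 𝒳 𝒴) (θ : Θ) (z : 𝒳 × 𝒴) : ℝ≥0 := M.condDensity θ z.1 z.2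

lemma measurable_dens_uncurry (M : RegressionModel Θ 𝒳 𝒴) :
    Measurable fun w : Θ × (𝒳 × 𝒴) => M.dens w.1 w.2 := M.measurable_condDensity

lemma measurable_dens (M : RegressionModel Θ 𝒳 𝒴) (θ : Θ) : Measurable (M.dens θ) :=
  M.measurable_dens_uncurry.comp measurable_prodMk_left

lemma law_eq (M : RegressionModel Θ 𝒳 𝒴) (θ : Θ) :
    M.law θ = M.baseRef.withDensity fun z => (M.dens θ z : ℝ≥0∞) := by
  have hc : Measurable fun x => (M.covDensity x : ℝ≥0∞) :=
    M.measurable_covDensity.coe_nnreal_ennreal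
  unfold law baseRef
  rw [prod_withDensity_left hc]
  exact withDensity_mul _ (hc.comp measurable_fst) (M.measurable_dens θ).coe_nnreal_ennreal

lemma lintegral_dens (M : RegressionModel Θ 𝒳 𝒴) (θ : Θ) :
    ∫⁻ z, (M.dens θ z : ℝ≥0∞) ∂M.baseRef = 1 := by
  unfold baseRef
  rw [lintegral_prod _ (M.measurable_dens θ).coe_nnreal_ennreal.aemeasurable]
  simp only [dens, M.lintegral_condDensity, lintegral_const, one_mul]
  rw [withDensity_apply _ MeasurableSet.univ, Measure.restrict_univ, M.lintegral_covDensity]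

instance (M : RegressionModel Θ 𝒳 𝒴) (θ : Θ) : IsProbabilityMeasure (M.law θ) := by
  rw [law_eq]
  exact isProbabilityMeasure_withDensity_of_lintegral_eq_one (M.lintegral_dens θ)

instance (M : RegressionModel Θ 𝒳 𝒴) (θ : Θ) (N : ℕ) : IsProbabilityMeasure (M.dataLaw θ N) := by
  unfold dataLaw; infer_instance

lemma measurable_likelihood_uncurry (M : RegressionModel Θ 𝒳 𝒴) {N : ℕ} :
    Measurable fun w : (Fin N → 𝒳 × 𝒴) × Θ => M.likelihood w.1 w.2 := by
  refine Finset.measurable_prod _ fun i _ => ?_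
  exact (M.measurable_dens_uncurry.comp
    (measurable_snd.prodMk ((measurable_pi_apply i).comp measurable_fst))).coe_nnreal_ennreal

lemma measurable_likelihood (M : RegressionModel Θ 𝒳 𝒴) {N : ℕ} (θ : Θ) :
    Measurable fun D : Fin N → 𝒳 × 𝒴 => M.likelihood D θ :=
  M.measurable_likelihood_uncurry.comp measurable_prodMk_right

lemma likelihood_ne_top (M : RegressionModel Θ 𝒳 𝒴) {N : ℕ} (D : Fin N → 𝒳 × 𝒴) (θ : Θ) :
    M.likelihood D θ ≠ ∞ :=
  ENNReal.prod_ne_top fun _ _ => ENNReal.coe_ne_top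

lemma dataLaw_eq (M : RegressionModel Θ 𝒳 𝒴) (θ : Θ) (N : ℕ) :
    M.dataLaw θ N =
      (Measure.pi fun _ : Fin N => M.baseRef).withDensity fun D => M.likelihood D θ := by
  unfold dataLaw
  simp_rw [law_eq]
  exact pi_withDensity_eq (M.measurable_dens θ)

lemma ae_law_dens_pos (M : RegressionModel Θ 𝒳 𝒴) (θ : Θ) : ∀ᵐ z ∂M.law θ, 0 < M.dens θ z := by
  rw [law_eq, ae_withDensity_iff (M.measurable_dens θ).coe_nnreal_ennreal]
  exact ae_of_all _ fun z hz => pos_iff_ne_zero.2 (by simpa using hz)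

lemma ae_dataLaw_of_ae_law (M : RegressionModel Θ 𝒳 𝒴) {θ : Θ} (N : ℕ) {q : 𝒳 × 𝒴 → Prop}
    (hq : ∀ᵐ z ∂M.law θ, q z) : ∀ᵐ D ∂M.dataLaw θ N, ∀ i, q (D i) :=
  ae_all_iff.2 fun i =>
    (Measure.quasiMeasurePreserving_eval (μ := fun _ : Fin N => M.law θ) i).ae hq

lemma ae_likelihood_ne_zero (M : RegressionModel Θ 𝒳 𝒴) (θ : Θ) (N : ℕ) :
    ∀ᵐ D ∂M.dataLaw θ N, M.likelihood D θ ≠ 0 := by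
  filter_upwards [M.ae_dataLaw_of_ae_law N (M.ae_law_dens_pos θ)] with D hD
  exact Finset.prod_ne_zero_iff.2 fun i _ => by simpa [dens] using (hD i).ne'

/-- Change of measure: integrating a likelihood ratio under the truth gives at most the probability
under the other parameter, with equality up to the set where the true density vanishes. -/
lemma setLIntegral_lintegral_likelihood_div_le (M : RegressionModel Θ 𝒳 𝒴) (θ₀ : Θ)
    (Pr : Measure Θ) [IsFiniteMeasure Pr] {N : ℕ} {E : Set (Fin N → 𝒳 × 𝒴)} (hE : MeasurableSet E)
    (A : Set Θ) :
    ∫⁻ D in E, (∫⁻ θ in A, M.likelihood D θ ∂Pr) / M.likelihood D θ₀ ∂M.dataLaw θ₀ N ≤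
      ∫⁻ θ in A, M.dataLaw θ N E ∂Pr := by
  have hm : Measurable fun w : (Fin N → 𝒳 × 𝒴) × Θ => M.likelihood w.1 w.2 / M.likelihood w.1 θ₀ :=
    M.measurable_likelihood_uncurry.div ((M.measurable_likelihood θ₀).comp measurable_fst)
  calc ∫⁻ D in E, (∫⁻ θ in A, M.likelihood D θ ∂Pr) / M.likelihood D θ₀ ∂M.dataLaw θ₀ N
      = ∫⁻ D in E, ∫⁻ θ in A, M.likelihood D θ / M.likelihood D θ₀ ∂Pr ∂M.dataLaw θ₀ N := by
        refine lintegral_congr fun D => ?_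
        simp_rw [div_eq_mul_inv]
        exact (lintegral_mul_const _
          (M.measurable_likelihood_uncurry.comp measurable_prodMk_left)).symm
    _ = ∫⁻ θ in A, ∫⁻ D in E, M.likelihood D θ / M.likelihood D θ₀ ∂M.dataLaw θ₀ N ∂Pr :=
        lintegral_lintegral_swap hm.aemeasurable
    _ ≤ ∫⁻ θ in A, M.dataLaw θ N E ∂Pr := by
        refine lintegral_mono fun θ => ?_
        rw [M.dataLaw_eq θ₀, M.dataLaw_eq θ, withDensity_apply _ hE]
        exact (setLIntegral_withDensity_eq_setLIntegral_mul _ (M.measurable_likelihood θ₀)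
          ((M.measurable_likelihood θ).div (M.measurable_likelihood θ₀)) hE).trans_le
            (lintegral_mono fun D => ENNReal.mul_div_le)

/-! ### Tests against the complement of a Hellinger ball -/

/-- One test against all `P_θ`, `θ ∈ A`, at distance more than `T e` from the truth: the union of
the robust tests for the points of a maximal `e / 2`-packing of these laws. -/
lemma exists_test_of_packingNum_le (M : RegressionModel Θ 𝒳 𝒴) (θ₀ : Θ) (N : ℕ) {A : Set Θ}
    {e T K : ℝ} (he : 0 < e) (hT : 0 < T) (hT2 : 28 ≤ T ^ 2)
    (hK : (packingNum (e / 2) (M.law '' A) hellingerDist : ℝ≥0∞) ≤ ENNReal.ofReal K) :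
    ∃ E : Set (Fin N → 𝒳 × 𝒴), MeasurableSet E ∧
      M.dataLaw θ₀ N E ≤
        ENNReal.ofReal K * ENNReal.ofReal (Real.exp (-(N * ((T * e) ^ 2 / 8)))) ∧
      ∀ θ ∈ A, T * e < hellingerDist (M.law θ) (M.law θ₀) →
        M.dataLaw θ N Eᶜ ≤ ENNReal.ofReal (Real.exp (-(N * ((T * e) ^ 2 / 8)))) := by
  obtain ⟨F, hFA, hFpw, hFnet⟩ := exists_packing_forall_exists_lt
    (d := hellingerDist (Ω := 𝒳 × 𝒴)) hellingerDist_comm hellingerDist_self (half_pos he)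
    (M.law '' {θ | θ ∈ A ∧ T * e < hellingerDist (M.law θ) (M.law θ₀)})
  have hcard : (F.encard : ℝ≥0∞) ≤ ENNReal.ofReal K :=
    (ENat.toENNReal_le.2 (encard_le_packingNum
      (hFA.trans (image_mono fun θ hθ => hθ.1)) hFpw)).trans hK
  have hfin : F.Finite := by
    rw [← Set.encard_ne_top_iff]
    intro h
    rw [h] at hcard
    simp at hcard
  have hexp : ∀ d : ℝ, T * e < d → ENNReal.ofReal (Real.exp (-(N * (d ^ 2 / 8)))) ≤
      ENNReal.ofReal (Real.exp (-(N * ((T * e) ^ 2 / 8)))) := fun d hd => by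
    have : 0 < T * e := by positivity
    gcongr
  have htest : ∀ Q ∈ F, ∃ E : Set (Fin N → 𝒳 × 𝒴), MeasurableSet E ∧
      M.dataLaw θ₀ N E ≤ ENNReal.ofReal (Real.exp (-(N * ((T * e) ^ 2 / 8)))) ∧
      ∀ θ, hellingerDist (M.law θ) Q < e / 2 →
        M.dataLaw θ N Eᶜ ≤ ENNReal.ofReal (Real.exp (-(N * ((T * e) ^ 2 / 8)))) := by
    intro Q hQ
    obtain ⟨θ₁, ⟨-, hθ₁⟩, rfl⟩ := hFA hQ
    rw [hellingerDist_comm] at hθ₁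
    obtain ⟨E, hE, hE0, hE1⟩ := exists_hellinger_test N
      (M.measurable_dens θ₀) (M.measurable_dens θ₁)
      (M.lintegral_dens θ₀) (M.lintegral_dens θ₁) rfl
    simp_rw [← law_eq] at hE0 hE1
    refine ⟨E, hE, hE0.trans (hexp _ hθ₁), fun θ hθ => ?_⟩
    have := hE1 (M.dens θ) (M.measurable_dens θ) (M.lintegral_dens θ)
    rw [← law_eq] at this
    refine (this ?_).trans (hexp _ hθ₁)
    have h0 := hellingerDist_nonneg (M.law θ) (M.law θ₁)
    have hr2 : hellingerDist (M.law θ) (M.law θ₁) ^ 2 ≤ (e / 2) ^ 2 := by gcongr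
    have hd2 : (T * e) ^ 2 ≤ hellingerDist (M.law θ₀) (M.law θ₁) ^ 2 := by gcongr
    nlinarith [sq_nonneg e]
  choose! E hEm hE0 hE1 using htest
  refine ⟨⋃ Q ∈ F, E Q, hfin.measurableSet_biUnion hEm, ?_, fun θ hθ hdist => ?_⟩
  · calc M.dataLaw θ₀ N (⋃ Q ∈ F, E Q)
        ≤ ∑ Q ∈ hfin.toFinset, M.dataLaw θ₀ N (E Q) := by
          have : ⋃ Q ∈ F, E Q = ⋃ Q ∈ hfin.toFinset, E Q := by simp
          rw [this]
          exact measure_biUnion_finset_le _ _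
      _ ≤ ∑ _Q ∈ hfin.toFinset, ENNReal.ofReal (Real.exp (-(N * ((T * e) ^ 2 / 8)))) :=
          Finset.sum_le_sum fun Q hQ => hE0 Q (hfin.mem_toFinset.1 hQ)
      _ ≤ ENNReal.ofReal K * ENNReal.ofReal (Real.exp (-(N * ((T * e) ^ 2 / 8)))) := by
          rw [Finset.sum_const, nsmul_eq_mul]
          gcongr
          rw [hfin.encard_eq_coe_toFinset_card] at hcard
          simpa using hcard
  · obtain ⟨Q, hQ, hQd⟩ := hFnet (M.law θ) ⟨θ, ⟨hθ, hdist⟩, rfl⟩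
    exact (measure_mono (compl_subset_compl.2 (subset_biUnion_of_mem hQ))).trans (hE1 Q hQ θ hQd)

end RegressionModel

/-! ### A lower bound for the evidence -/

/-- **Jensen's inequality** for the exponential; the right-hand side may be infinite. -/
lemma ofReal_exp_integral_le {α : Type*} [MeasurableSpace α] {ν : Measure α}
    [IsProbabilityMeasure ν] {X : α → ℝ} (hX : Integrable X ν) :
    ENNReal.ofReal (Real.exp (∫ a, X a ∂ν)) ≤ ∫⁻ a, ENNReal.ofReal (Real.exp (X a)) ∂ν := by
  by_cases htop : ∫⁻ a, ENNReal.ofReal (Real.exp (X a)) ∂ν = ∞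
  · rw [htop]; exact le_top
  have hexp : Integrable (fun a => Real.exp (X a)) ν := by
    refine ⟨Real.continuous_exp.comp_aestronglyMeasurable hX.1, ?_⟩
    rw [hasFiniteIntegral_iff_ofReal (ae_of_all _ fun a => (Real.exp_pos _).le)]
    exact lt_top_iff_ne_top.2 htop
  rw [← ofReal_integral_eq_lintegral_ofReal hexp (ae_of_all _ fun a => (Real.exp_pos _).le)]
  exact ENNReal.ofReal_le_ofReal (convexOn_exp.map_integral_le Real.continuous_exp.continuousOn
    isClosed_univ (ae_of_all _ fun _ => mem_univ _) hX hexp)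

lemma sq_integral_le_integral_sq {α : Type*} [MeasurableSpace α] {ν : Measure α}
    [IsProbabilityMeasure ν] {X : α → ℝ} (hX : MemLp X 2 ν) :
    (∫ a, X a ∂ν) ^ 2 ≤ ∫ a, X a ^ 2 ∂ν := by
  have h1 := variance_nonneg X ν
  rw [variance_eq_sub hX] at h1
  simp only [Pi.pow_apply] at h1
  linarith

/-- Chebyshev's inequality for the lower tail of a sum of independent copies of `g`. -/
lemma pi_sum_lt_le {Z : Type*} [MeasurableSpace Z] {μ : Measure Z} [IsProbabilityMeasure μ]
    {g : Z → ℝ} (hg : MemLp g 2 μ) {N : ℕ} (hN : 1 ≤ N) {e : ℝ} (he : 0 < e)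
    (hmean : -e ^ 2 ≤ ∫ z, g z ∂μ) (hsq : ∫ z, g z ^ 2 ∂μ ≤ e ^ 2) :
    (Measure.pi fun _ : Fin N => μ) {x | ∑ i, g (x i) < -(2 * (N * e ^ 2))} ≤
      ENNReal.ofReal (1 / (N * e ^ 2)) := by
  have hN0 : (0 : ℝ) < N := by exact_mod_cast hN
  have ht : 0 < N * e ^ 2 := by positivity
  have hgi : ∀ i : Fin N, MemLp (fun x : Fin N → Z => g (x i)) 2 (Measure.pi fun _ : Fin N => μ) :=
    fun i => hg.comp_measurePreserving (measurePreserving_eval _ i)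
  have hS : MemLp (∑ i, fun x : Fin N → Z => g (x i)) 2 (Measure.pi fun _ : Fin N => μ) :=
    memLp_finsetSum' _ fun i _ => hgi i
  have hvar : Var[∑ i, fun x : Fin N → Z => g (x i); Measure.pi fun _ : Fin N => μ] ≤
      N * e ^ 2 := by
    rw [variance_sum_pi fun _ => hg, Finset.sum_const, Finset.card_univ, Fintype.card_fin,
      nsmul_eq_mul]
    gcongr
    exact (variance_le_expectation_sq hg.1).trans hsq
  have hE : ∫ x, (∑ i, fun x : Fin N → Z => g (x i)) x ∂(Measure.pi fun _ : Fin N => μ) =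
      N * ∫ z, g z ∂μ := by
    simp only [Finset.sum_apply]
    rw [integral_finsetSum _ fun i _ => (hgi i).integrable one_le_two]
    simp_rw [fun i : Fin N => integral_comp_eval (μ := fun _ : Fin N => μ) (i := i) hg.1]
    simp
  refine (measure_mono ?_).trans ((meas_ge_le_variance_div_sq hS ht).trans ?_)
  · intro x hx
    rw [mem_ofPred_eq] at hx ⊢
    rw [hE, Finset.sum_apply, abs_sub_comm]
    refine le_trans ?_ (le_abs_self _)
    nlinarith [mul_le_mul_of_nonneg_left hmean hN0.le]
  · apply ENNReal.ofReal_le_ofReal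
    calc _ ≤ (N * e ^ 2) / (N * e ^ 2) ^ 2 := by gcongr
      _ = 1 / (N * e ^ 2) := by field_simp

namespace RegressionModel

variable {Θ 𝒳 𝒴 : Type*} [MeasurableSpace Θ] [MeasurableSpace 𝒳] [MeasurableSpace 𝒴]

lemma measurable_logRatio_uncurry (M : RegressionModel Θ 𝒳 𝒴) (θ₀ : Θ) :
    Measurable fun w : Θ × (𝒳 × 𝒴) => M.logRatio θ₀ w.1 w.2 :=
  (M.measurable_dens_uncurry.coe_nnreal_real.div
    ((M.measurable_dens θ₀).comp measurable_snd).coe_nnreal_real).log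

lemma measurableSet_klNhd (M : RegressionModel Θ 𝒳 𝒴) (θ₀ : Θ) (e : ℝ) :
    MeasurableSet (M.klNhd θ₀ e) := by
  have hl := M.measurable_logRatio_uncurry θ₀
  have h1 : MeasurableSet {θ | ∀ᵐ z ∂M.law θ₀, 0 < M.condDensity θ z.1 z.2} := by
    have : MeasurableSet {w : Θ × (𝒳 × 𝒴) | 0 < M.dens w.1 w.2}ᶜ :=
      (measurableSet_lt measurable_const M.measurable_dens_uncurry).compl
    exact measurable_measure_prodMk_left (ν := M.law θ₀) this (measurableSet_singleton 0)
  have h2 : MeasurableSet {θ | -(∫ z, M.logRatio θ₀ θ z ∂M.law θ₀) ≤ e ^ 2} :=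
    measurableSet_le (hl.stronglyMeasurable.integral_prod_right (ν := M.law θ₀)).measurable.neg
      measurable_const
  have h3 : MeasurableSet {θ | ∫⁻ z, ENNReal.ofReal (M.logRatio θ₀ θ z ^ 2) ∂M.law θ₀ ≤
      ENNReal.ofReal (e ^ 2)} :=
    measurableSet_le ((hl.pow_const 2).ennreal_ofReal.lintegral_prod_right' (ν := M.law θ₀))
      measurable_const
  exact h1.inter (h2.inter h3)

/-- The log-likelihood ratio averaged over a probability measure on the Kullback–Leibler
neighbourhood inherits the moment bounds that define the neighbourhood. -/
lemma memLp_integral_logRatio (M : RegressionModel Θ 𝒳 𝒴) (θ₀ : Θ) {ν : Measure Θ}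
    [IsProbabilityMeasure ν] {e : ℝ} (hν : ∀ᵐ θ ∂ν, θ ∈ M.klNhd θ₀ e) :
    (∀ᵐ z ∂M.law θ₀, Integrable (fun θ => M.logRatio θ₀ θ z) ν) ∧
      MemLp (fun z => ∫ θ, M.logRatio θ₀ θ z ∂ν) 2 (M.law θ₀) ∧
      -e ^ 2 ≤ ∫ z, ∫ θ, M.logRatio θ₀ θ z ∂ν ∂M.law θ₀ ∧
      ∫ z, (∫ θ, M.logRatio θ₀ θ z ∂ν) ^ 2 ∂M.law θ₀ ≤ e ^ 2 := by
  set P := M.law θ₀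
  set l : Θ × (𝒳 × 𝒴) → ℝ := fun w => M.logRatio θ₀ w.1 w.2
  have hlm : Measurable l := M.measurable_logRatio_uncurry θ₀
  have hle : ∫⁻ w, ENNReal.ofReal (l w ^ 2) ∂(ν.prod P) ≤ ENNReal.ofReal (e ^ 2) := by
    rw [lintegral_prod _ (hlm.pow_const 2).ennreal_ofReal.aemeasurable]
    calc ∫⁻ θ, ∫⁻ z, ENNReal.ofReal (l (θ, z) ^ 2) ∂P ∂ν
        ≤ ∫⁻ _θ, ENNReal.ofReal (e ^ 2) ∂ν := lintegral_mono_ae (hν.mono fun θ hθ => hθ.2.2)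
      _ = ENNReal.ofReal (e ^ 2) := by simp
  have hl2i : Integrable (fun w => l w ^ 2) (ν.prod P) := by
    refine ⟨(hlm.pow_const 2).aestronglyMeasurable, ?_⟩
    rw [hasFiniteIntegral_iff_ofReal (ae_of_all _ fun w => sq_nonneg _)]
    exact hle.trans_lt ENNReal.ofReal_lt_top
  have hl2 : MemLp l 2 (ν.prod P) :=
    (memLp_two_iff_integrable_sq hlm.aestronglyMeasurable).2 hl2i
  have hli : Integrable l (ν.prod P) := hl2.integrable one_le_two
  have hsec : ∀ᵐ z ∂P, MemLp (fun θ => l (θ, z)) 2 ν := by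
    filter_upwards [hl2i.prod_left_ae] with z hz
    exact (memLp_two_iff_integrable_sq
      (hlm.comp measurable_prodMk_right).aestronglyMeasurable).2 hz
  have hsq : ∀ᵐ z ∂P, (∫ θ, l (θ, z) ∂ν) ^ 2 ≤ ∫ θ, l (θ, z) ^ 2 ∂ν :=
    hsec.mono fun z hz => sq_integral_le_integral_sq hz
  have hgm : AEStronglyMeasurable (fun z => ∫ θ, l (θ, z) ∂ν) P :=
    hli.integral_prod_right.aestronglyMeasurable
  have hg2i : Integrable (fun z => (∫ θ, l (θ, z) ∂ν) ^ 2) P := by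
    refine hl2i.integral_prod_right.mono (hgm.pow 2) (hsq.mono fun z hz => ?_)
    rw [Real.norm_of_nonneg (sq_nonneg _)]
    exact hz.trans (le_abs_self _)
  refine ⟨hsec.mono fun z hz => hz.integrable one_le_two,
    (memLp_two_iff_integrable_sq hgm).2 hg2i, ?_, ?_⟩
  · calc -e ^ 2 = ∫ _θ, -e ^ 2 ∂ν := by simp
      _ ≤ ∫ θ, ∫ z, l (θ, z) ∂P ∂ν :=
        integral_mono_ae (integrable_const _) hli.integral_prod_left
          (hν.mono fun θ hθ => neg_le.1 hθ.2.1)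
      _ = ∫ z, ∫ θ, l (θ, z) ∂ν ∂P := integral_integral_swap hli
  · calc ∫ z, (∫ θ, l (θ, z) ∂ν) ^ 2 ∂P ≤ ∫ z, ∫ θ, l (θ, z) ^ 2 ∂ν ∂P :=
        integral_mono_ae hg2i hl2i.integral_prod_right hsq
      _ = ∫ w, l w ^ 2 ∂(ν.prod P) := (integral_prod_symm _ hl2i).symm
      _ ≤ e ^ 2 := by
        rw [integral_eq_lintegral_of_nonneg_ae (ae_of_all _ fun w => sq_nonneg _)
          (hlm.pow_const 2).aestronglyMeasurable]
        exact ENNReal.toReal_le_of_le_ofReal (sq_nonneg e) hle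

/-- Where the densities are positive, the averaged likelihood is bounded below by Jensen's
inequality. -/
lemma likelihood_mul_exp_le_lintegral (M : RegressionModel Θ 𝒳 𝒴) (θ₀ : Θ) {ν : Measure Θ}
    [IsProbabilityMeasure ν] {N : ℕ} {D : Fin N → 𝒳 × 𝒴} (h₀ : ∀ i, 0 < M.dens θ₀ (D i))
    (hpos : ∀ i, ∀ᵐ θ ∂ν, 0 < M.dens θ (D i))
    (hint : ∀ i, Integrable (fun θ => M.logRatio θ₀ θ (D i)) ν) :
    M.likelihood D θ₀ * ENNReal.ofReal (Real.exp (∑ i, ∫ θ, M.logRatio θ₀ θ (D i) ∂ν)) ≤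
      ∫⁻ θ, M.likelihood D θ ∂ν := by
  rw [← integral_finsetSum _ fun i _ => hint i]
  calc M.likelihood D θ₀ *
        ENNReal.ofReal (Real.exp (∫ θ, ∑ i, M.logRatio θ₀ θ (D i) ∂ν))
      ≤ M.likelihood D θ₀ *
        ∫⁻ θ, ENNReal.ofReal (Real.exp (∑ i, M.logRatio θ₀ θ (D i))) ∂ν := by
        gcongr
        exact ofReal_exp_integral_le (integrable_finsetSum _ fun i _ => hint i)
    _ = ∫⁻ θ, M.likelihood D θ₀ *
        ENNReal.ofReal (Real.exp (∑ i, M.logRatio θ₀ θ (D i))) ∂ν :=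
        (lintegral_const_mul' _ _ (M.likelihood_ne_top D θ₀)).symm
    _ = ∫⁻ θ, M.likelihood D θ ∂ν := by
        refine lintegral_congr_ae ?_
        filter_upwards [ae_all_iff.2 hpos] with θ hθ
        rw [Real.exp_sum, ENNReal.ofReal_prod_of_nonneg fun i _ => (Real.exp_pos _).le]
        unfold likelihood
        rw [← Finset.prod_mul_distrib]
        refine Finset.prod_congr rfl fun i _ => ?_
        have ha : (0 : ℝ) < M.dens θ₀ (D i) := by exact_mod_cast h₀ i
        have hb : (0 : ℝ) < M.dens θ (D i) := by exact_mod_cast hθ i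
        change (M.dens θ₀ (D i) : ℝ≥0∞) *
          ENNReal.ofReal (Real.exp (Real.log ((M.dens θ (D i) : ℝ) / M.dens θ₀ (D i)))) =
          M.dens θ (D i)
        rw [Real.exp_log (div_pos hb ha), ← ENNReal.ofReal_coe_nnreal (p := M.dens θ₀ (D i)),
          ← ENNReal.ofReal_mul ha.le, mul_div_cancel₀ _ ha.ne', ENNReal.ofReal_coe_nnreal]

/-- If the prior charges the Kullback–Leibler neighbourhood, then the denominator of the posterior
is rarely much smaller than the true likelihood. -/
lemma dataLaw_evidence_lt_le (M : RegressionModel Θ 𝒳 𝒴) (θ₀ : Θ) (Pr : Measure Θ)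
    [IsProbabilityMeasure Pr] {N : ℕ} (hN : 1 ≤ N) {e C : ℝ} (he : 0 < e)
    (hPr : ENNReal.ofReal (Real.exp (-((N : ℝ) * e ^ 2 * C))) ≤ Pr (M.klNhd θ₀ e)) :
    M.dataLaw θ₀ N {D | ∫⁻ θ, M.likelihood D θ ∂Pr <
        M.likelihood D θ₀ * ENNReal.ofReal (Real.exp (-((N : ℝ) * e ^ 2 * (C + 2))))} ≤
      ENNReal.ofReal (1 / (N * e ^ 2)) := by
  set B := M.klNhd θ₀ e
  have hB0 : Pr B ≠ 0 := fun h => by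
    rw [h, nonpos_iff_eq_zero, ENNReal.ofReal_eq_zero] at hPr
    exact absurd hPr (not_le.2 (Real.exp_pos _))
  have := cond_isProbabilityMeasure hB0
  have hν : ∀ᵐ θ ∂Pr[|B], θ ∈ B := ae_cond_mem (M.measurableSet_klNhd θ₀ e)
  obtain ⟨hint, hL2, hmean, hsq⟩ := M.memLp_integral_logRatio θ₀ hν
  have hpos : ∀ᵐ z ∂M.law θ₀, ∀ᵐ θ ∂Pr[|B], 0 < M.dens θ z := by
    have hms : MeasurableSet {w : Θ × (𝒳 × 𝒴) | 0 < M.dens w.1 w.2} :=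
      measurableSet_lt measurable_const M.measurable_dens_uncurry
    exact (Measure.ae_ae_comm hms).1 (hν.mono fun θ hθ => hθ.1)
  refine (measure_mono_ae ?_).trans (pi_sum_lt_le hL2 hN he hmean hsq)
  filter_upwards [M.ae_dataLaw_of_ae_law N (M.ae_law_dens_pos θ₀),
    M.ae_dataLaw_of_ae_law N hpos, M.ae_dataLaw_of_ae_law N hint] with D h₀ hp hi hD
  change ∑ i, ∫ θ, M.logRatio θ₀ θ (D i) ∂Pr[|B] < _
  by_contra! hge
  refine absurd hD (not_lt.2 ?_)
  calc M.likelihood D θ₀ * ENNReal.ofReal (Real.exp (-((N : ℝ) * e ^ 2 * (C + 2))))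
      = ENNReal.ofReal (Real.exp (-((N : ℝ) * e ^ 2 * C))) * (M.likelihood D θ₀ *
          ENNReal.ofReal (Real.exp (-(2 * (N * e ^ 2))))) := by
        rw [mul_left_comm, ← ENNReal.ofReal_mul (Real.exp_pos _).le, ← Real.exp_add]
        congr 3; ring
    _ ≤ Pr B * ∫⁻ θ, M.likelihood D θ ∂Pr[|B] := by
        refine mul_le_mul' hPr (le_trans ?_ (M.likelihood_mul_exp_le_lintegral θ₀ h₀ hp hi))
        gcongr
    _ = ∫⁻ θ in B, M.likelihood D θ ∂Pr := by
        rw [ProbabilityTheory.cond, lintegral_smul_measure, smul_eq_mul, ← mul_assoc,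
          ENNReal.mul_inv_cancel hB0 (measure_ne_top _ _), one_mul]
    _ ≤ ∫⁻ θ, M.likelihood D θ ∂Pr := setLIntegral_le_lintegral _ _

end RegressionModel

/-! ### Posterior concentration -/

namespace RegressionModel

variable {Θ 𝒳 𝒴 : Type*} [MeasurableSpace Θ] [MeasurableSpace 𝒳] [MeasurableSpace 𝒴]

/-- The posterior mass of `A` is rarely large unless the test with rejection region `E` rejects or
the evidence is small: on `A ∩ S` this is due to the power of the test, and off `S` to the prior. -/
lemma dataLaw_lt_posterior_le (M : RegressionModel Θ 𝒳 𝒴) (θ₀ : Θ) (Pr : Measure Θ)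
    [IsProbabilityMeasure Pr] {N : ℕ} {E : Set (Fin N → 𝒳 × 𝒴)} (hE : MeasurableSet E)
    {A S : Set Θ} {a b c δ : ℝ} (hc : 0 < c) (hδ : 0 < δ)
    (htest : ∀ θ ∈ A ∩ S, M.dataLaw θ N Eᶜ ≤ ENNReal.ofReal a)
    (hprior : Pr Sᶜ ≤ ENNReal.ofReal b) :
    M.dataLaw θ₀ N {D | ENNReal.ofReal δ < M.posterior Pr D A} ≤
      M.dataLaw θ₀ N E +
      M.dataLaw θ₀ N {D | ∫⁻ θ, M.likelihood D θ ∂Pr < M.likelihood D θ₀ * ENNReal.ofReal c} +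
      (ENNReal.ofReal a + ENNReal.ofReal b) / ENNReal.ofReal (δ * c) := by
  set num : (Fin N → 𝒳 × 𝒴) → ℝ≥0∞ := fun D =>
    (∫⁻ θ in A, M.likelihood D θ ∂Pr) / M.likelihood D θ₀
  have hnum : Measurable num :=
    (M.measurable_likelihood_uncurry.lintegral_prod_right' (ν := Pr.restrict A)).div
      (M.measurable_likelihood θ₀)
  have hbound : ∫⁻ D in Eᶜ, num D ∂M.dataLaw θ₀ N ≤ ENNReal.ofReal a + ENNReal.ofReal b := by
    calc ∫⁻ D in Eᶜ, num D ∂M.dataLaw θ₀ N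
        ≤ ∫⁻ θ in A, M.dataLaw θ N Eᶜ ∂Pr :=
          M.setLIntegral_lintegral_likelihood_div_le θ₀ Pr hE.compl A
      _ ≤ ∫⁻ θ in (A ∩ S) ∪ Sᶜ, M.dataLaw θ N Eᶜ ∂Pr := by
          refine lintegral_mono_set fun θ hθ => ?_
          by_cases h : θ ∈ S
          · exact Or.inl ⟨hθ, h⟩
          · exact Or.inr h
      _ ≤ ∫⁻ θ in A ∩ S, M.dataLaw θ N Eᶜ ∂Pr + ∫⁻ θ in Sᶜ, M.dataLaw θ N Eᶜ ∂Pr :=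
          lintegral_union_le _ _ _
      _ ≤ ∫⁻ _θ in A ∩ S, ENNReal.ofReal a ∂Pr + ∫⁻ _θ in Sᶜ, 1 ∂Pr :=
          add_le_add (setLIntegral_mono measurable_const htest)
            (lintegral_mono fun θ => prob_le_one)
      _ ≤ ENNReal.ofReal a + ENNReal.ofReal b := by
          rw [setLIntegral_const, setLIntegral_one]
          exact add_le_add (mul_le_of_le_one_right zero_le prob_le_one) hprior
  have hmarkov : M.dataLaw θ₀ N ({D | ENNReal.ofReal (δ * c) ≤ num D} ∩ Eᶜ) ≤
      (ENNReal.ofReal a + ENNReal.ofReal b) / ENNReal.ofReal (δ * c) := by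
    rw [← Measure.restrict_apply' hE.compl]
    refine (meas_ge_le_lintegral_div hnum.aemeasurable ?_ ENNReal.ofReal_ne_top).trans
      (ENNReal.div_le_div_right hbound _)
    simpa using mul_pos hδ hc
  refine (measure_mono_ae ?_).trans (((measure_union_le _ _).trans
    (add_le_add_left (measure_union_le _ _) _)).trans (add_le_add_right hmarkov _))
  filter_upwards [M.ae_likelihood_ne_zero θ₀ N] with D hD0 hD
  by_cases hDE : D ∈ E
  · exact Or.inl (Or.inl hDE)
  by_cases hDm : ∫⁻ θ, M.likelihood D θ ∂Pr < M.likelihood D θ₀ * ENNReal.ofReal c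
  · exact Or.inl (Or.inr hDm)
  refine Or.inr ⟨?_, hDE⟩
  have hlt : ENNReal.ofReal δ * ∫⁻ θ, M.likelihood D θ ∂Pr <
      ∫⁻ θ in A, M.likelihood D θ ∂Pr := by
    by_contra! hle
    exact absurd hD (not_lt.2 (ENNReal.div_le_of_le_mul hle))
  change ENNReal.ofReal (δ * c) ≤ _ / _
  rw [ENNReal.le_div_iff_mul_le (Or.inl hD0) (Or.inl (M.likelihood_ne_top D θ₀)),
    ENNReal.ofReal_mul hδ.le, mul_assoc, mul_comm (ENNReal.ofReal c)]
  exact (mul_le_mul_right (not_lt.1 hDm) _).trans hlt.le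

end RegressionModel

theorem theorem1 :
    ∃ L : ℝ, 0 < L ∧
      ∀ (Θ : Type u) (𝒳 : Type v) (𝒴 : Type w)
        [MeasurableSpace Θ] [MeasurableSpace 𝒳] [MeasurableSpace 𝒴]
        (M : RegressionModel Θ 𝒳 𝒴) (θ₀ : Θ) (Pr : Measure Θ) [IsProbabilityMeasure Pr]
        (ε : ℕ → ℝ) (C : ℝ) (S : ℕ → Set Θ),
        (∀ N, 0 < ε N) →
        Tendsto ε atTop (𝓝 0) →
        Tendsto (fun N : ℕ => (N : ℝ) * ε N ^ 2) atTop atTop →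
        0 < C →
        (∀ N, MeasurableSet (S N)) →
        (∀ N : ℕ, 1 ≤ N →
          ENNReal.log (packingNum (ε N / 2) (M.law '' S N) hellingerDist : ℝ≥0∞)
            ≤ (((N : ℝ) * ε N ^ 2 : ℝ) : EReal)) →
        (∀ N : ℕ, 1 ≤ N →
          Pr (S N)ᶜ ≤ ENNReal.ofReal (Real.exp (-((N : ℝ) * ε N ^ 2 * (C + 4))))) →
        (∀ N : ℕ, 1 ≤ N →
          ENNReal.ofReal (Real.exp (-((N : ℝ) * ε N ^ 2 * C))) ≤ Pr (M.klNhd θ₀ (ε N))) →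
        ∀ T δ : ℝ, 0 < T → C + 4 ≤ L * T ^ 2 → L < L * T ^ 2 - 1 → 0 < δ → δ < 1 →
          ∀ N : ℕ, 1 ≤ N →
            M.dataLaw θ₀ N {D | ENNReal.ofReal δ < M.posterior Pr D
                {θ | T * ε N < hellingerDist (M.law θ) (M.law θ₀)}}
              ≤ ENNReal.ofReal (1 / ((N : ℝ) * ε N ^ 2 * δ)
                  + 2 * Real.exp (-(L * ((N : ℝ) * ε N ^ 2))) / δ
                  + 2 * Real.exp (-(2 * ((N : ℝ) * ε N ^ 2))) / δ) := by
  -- The second condition on `T` gives `T² > 1 + 1 / L = 28`, so that the radius `ε N / 2` of the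
  -- covering balls is small enough, compared with `T * ε N`, for the robust tests.
  refine ⟨1 / 27, by norm_num, ?_⟩
  intro Θ 𝒳 𝒴 _ _ _ M θ₀ Pr _ ε C S hε _ _ hC hS hpack hprior hkl T δ hT hT1 hT2 hδ hδ1 N hN
  have he := hε N
  have hN0 : (0 : ℝ) < N := by exact_mod_cast hN
  set t : ℝ := (N : ℝ) * ε N ^ 2 with ht
  have htpos : 0 < t := by positivity
  have hK : (packingNum (ε N / 2) (M.law '' S N) hellingerDist : ℝ≥0∞) ≤
      ENNReal.ofReal (Real.exp t) := by
    rw [← ENNReal.log_le_log_iff, ENNReal.log_ofReal_of_pos (Real.exp_pos _), Real.log_exp]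
    exact hpack N hN
  obtain ⟨E, hE, hE0, hE1⟩ := M.exists_test_of_packingNum_le θ₀ N he hT (by linarith) hK
  have hexpo : (N : ℝ) * ((T * ε N) ^ 2 / 8) = t * (T ^ 2 / 8) := by rw [ht]; ring
  rw [hexpo] at hE0 hE1
  have hE0' : M.dataLaw θ₀ N E ≤ ENNReal.ofReal (Real.exp (-(1 / 27 * t))) := by
    refine hE0.trans ?_
    rw [← ENNReal.ofReal_mul (Real.exp_pos _).le, ← Real.exp_add]
    apply ENNReal.ofReal_le_ofReal
    gcongr
    nlinarith
  have hE1' : ∀ θ ∈ {θ | T * ε N < hellingerDist (M.law θ) (M.law θ₀)} ∩ S N,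
      M.dataLaw θ N Eᶜ ≤ ENNReal.ofReal (Real.exp (-(t * (C + 4)))) := fun θ hθ => by
    refine (hE1 θ hθ.2 hθ.1).trans (ENNReal.ofReal_le_ofReal ?_)
    gcongr
    nlinarith [sq_nonneg T]
  refine (M.dataLaw_lt_posterior_le θ₀ Pr hE (Real.exp_pos (-(t * (C + 2)))) hδ hE1'
    (hprior N hN)).trans ((add_le_add_left (add_le_add hE0'
      (M.dataLaw_evidence_lt_le θ₀ Pr hN he (hkl N hN))) _).trans ?_)
  have hexp : Real.exp (-(t * (C + 4))) = Real.exp (-(2 * t)) * Real.exp (-(t * (C + 2))) := by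
    rw [← Real.exp_add]; congr 1; ring
  rw [← ENNReal.ofReal_add (Real.exp_pos _).le (Real.exp_pos _).le,
    ← ENNReal.ofReal_div_of_pos (mul_pos hδ (Real.exp_pos _)),
    ← ENNReal.ofReal_add (Real.exp_pos _).le (by positivity),
    ← ENNReal.ofReal_add (by positivity) (by positivity)]
  apply ENNReal.ofReal_le_ofReal
  have h1 : (Real.exp (-(t * (C + 4))) + Real.exp (-(t * (C + 4)))) /
      (δ * Real.exp (-(t * (C + 2)))) = 2 * Real.exp (-(2 * t)) / δ := by
    rw [hexp, ← two_mul, ← mul_assoc, mul_div_mul_right _ _ (Real.exp_pos _).ne']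
  have h2 : 1 / t ≤ 1 / (t * δ) :=
    one_div_le_one_div_of_le (by positivity) (by nlinarith)
  have h3 : Real.exp (-(1 / 27 * t)) ≤ 2 * Real.exp (-(1 / 27 * t)) / δ := by
    rw [le_div_iff₀ hδ]
    nlinarith [Real.exp_pos (-(1 / 27 * t))]
  rw [h1]
  linarith
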